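/- Let $p$ be a prime number, let $k$ be an algebraically closed field of characteristic $p$, and let $\lambda \geq 1$ be an integer. A meromorphic differential form on $\mathbb{P}^1_k$ is an expression $\omega = f\,dX$ with $f \in k(X)$. If $\omega\neq 0$, its order at $a \in k$ is $\mathrm{ord}_a(f)$, and its order at $\infty$ is $\mathrm{ord}_0(f(1/X)) - 2$; a zero of $\omega$ is a point of $\mathbb{P}^1(k)=k\cup\{\infty\}$ at which the order is positive. The form $\omega$ is called logarithmic if $\omega = dF/F$ for some $F \in k(X)^\times$. For integers $m, n \geq 1$, a space $L_{m+1,n}$ is an $n$-dimensional $\mathbb{F}_p$-vector space $\Omega$ of meromorphic differential forms on $\mathbb{P}^1_k$ such that every nonzero $\omega \in \Omega$ is logarithmic, has order exactly $m-1$ at $\infty$, and has no zero in $k$. **Theorem.** If $p > 3\lambda$, then there is no space $L_{\lambda p, 2}$; that is, there is no $2$-dimensional $\mathbb{F}_p$-vector space of meromorphic differential forms on $\mathbb{P}^1_k$ all of whose nonzero elements are logarithmic with a unique zero, located at $\infty$ and of order $\lambda p - 2$. -/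

import Mathlib

noncomputable section

namespace LogForms

variable (k : Type*) [Field k]

/-- Meromorphic differential forms on the projective line over `k`: the Kähler differentials of
the function field `k(X)` over `k`. -/
abbrev MeroForm : Type _ := KaehlerDifferential k (RatFunc k)

/-- The differential form `dX`. -/
def dX : MeroForm k := KaehlerDifferential.D k (RatFunc k) RatFunc.X

/-- Every meromorphic form can be written in exactly one way as `f dX` with `f ∈ k(X)`. -/
theorem existsUnique_smul_dX (ω : MeroForm k) : ∃! f : RatFunc k, f • dX k = ω := by
  have : Algebra.FormallyEtale (Polynomial k) (RatFunc k) :=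
    Algebra.FormallyEtale.of_isLocalization (nonZeroDivisors (Polynomial k))
  let e : RatFunc k ≃ₗ[RatFunc k] MeroForm k :=
    (TensorProduct.AlgebraTensorModule.rid (Polynomial k) (RatFunc k) (RatFunc k)).symm ≪≫ₗ
      (TensorProduct.AlgebraTensorModule.congr (LinearEquiv.refl (RatFunc k) (RatFunc k))
        (KaehlerDifferential.polynomialEquiv k).symm) ≪≫ₗ
      KaehlerDifferential.tensorKaehlerEquivOfFormallyEtale k (Polynomial k) (RatFunc k)
  have he : ∀ f : RatFunc k, e f = f • dX k := by
    intro f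
    simp [e, dX, KaehlerDifferential.mapBaseChange_tmul]
  obtain ⟨f, hf⟩ := e.surjective ω
  refine ⟨f, by simpa [he] using hf, fun g hg => e.injective ?_⟩
  rw [hf, he]
  exact hg

variable {k}

/-- The rational function `f` with `ω = f dX`. -/
def coeff (ω : MeroForm k) : RatFunc k := (existsUnique_smul_dX k ω).choose

theorem coeff_smul_dX (ω : MeroForm k) : coeff ω • dX k = ω :=
  (existsUnique_smul_dX k ω).choose_spec.1

theorem coeff_unique (f : RatFunc k) : coeff (f • dX k) = f :=
  ((existsUnique_smul_dX k (f • dX k)).choose_spec.2 f rfl).symm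

/-- The order of a nonzero form `ω = f dX` at a point of `ℙ¹(k) = k ∪ {∞}`: at a finite point `a`
it is the order of `f` at `a`, and at infinity it is the order of `f(1/X)` at `0` (which is minus
the degree of `f`) minus `2`. -/
def ordAt (ω : MeroForm k) : OnePoint k → ℤ
  | some a => ((coeff ω).num.rootMultiplicity a : ℤ) - ((coeff ω).denom.rootMultiplicity a : ℤ)
  | none => -(coeff ω).intDegree - 2

/-- A form is logarithmic if it is of the form `dF / F` for a nonzero rational function `F`. -/
def IsLogarithmic (ω : MeroForm k) : Prop :=
  ∃ F : RatFunc k, F ≠ 0 ∧ ω = F⁻¹ • KaehlerDifferential.D k (RatFunc k) F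

/-- `IsSpaceL p N n Ω` (for `N ≥ 2`, `n ≥ 1`): the `𝔽_p`-vector space `Ω` of forms is a space
`L_{N,n}`, that is, it has dimension `n`, and every nonzero element of it is logarithmic, has
order `N - 2` at infinity and has no zero at any finite point. -/
structure IsSpaceL (p : ℕ) [Fact p.Prime] [Algebra (ZMod p) k] (N n : ℕ)
    (Ω : Submodule (ZMod p) (MeroForm k)) : Prop where
  rank_eq : Module.rank (ZMod p) Ω = n
  isLogarithmic : ∀ ω ∈ Ω, ω ≠ 0 → IsLogarithmic ω
  ordAt_infty : ∀ ω ∈ Ω, ω ≠ 0 → ordAt ω OnePoint.infty = (N : ℤ) - 2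
  not_zero_finite : ∀ ω ∈ Ω, ω ≠ 0 → ∀ a : k, ¬ 0 < ordAt ω (a : OnePoint k)

end LogForms

end

/-!
A nonzero form of the space has no finite zero, so it is `u dX / P` with `u` constant and
`deg P = l p`. As it is the logarithmic derivative of a polynomial, its poles are simple and its
residues `u / P'(x)` lie in the prime field (`IsSpaceL.exists_denominator`).

Two independent forms give coprime polynomials `A`, `B` such that all the fibres `B - n A`, `n` in
the prime field, have the same degree. The fibres for different `n` are disjoint, and together they
form the pole divisor of the first form: up to a constant `P = ∏ (B - n A) = B ^ p - A ^ (p - 1) B`,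
whence the degree of the pencil is `l`. The derivative of this product is `A ^ (p - 2) W` with
`W = A' B - A B'`, so `γ / (A ^ (p - 2) W)` takes values in the prime field on every fibre over the
prime field, for some constant `γ ≠ 0` (`pencil_of_residues`).

The product of these values along the fibre over `n` is computed by exchanging the arguments of
resultants (`norm_comm`). Write `a`, `b` for the leading coefficients of `A`, `B`, and put
`s(z) = b - z a`, `t(z) = b ^ p - z a ^ p`, `r(z) = b ^ (p ^ 2) - z a ^ (p ^ 2)`. Let `w(z)` be the
product of `B(c) - z A(c)` over the zeros `c` of `W`, and `ν = 2 l - deg W ≥ 1`. Up to constants the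
product of the values is `t ^ l / (w s ^ ν)` at `n`. Since it lies in the prime field it equals its
`p`-th power `r ^ l / (w^σ t ^ ν)`, where `w^σ` has the Frobenius applied to the coefficients.
Hence `r ^ l w s ^ ν` and `w^σ t ^ (l + ν)` are proportional at the `p` points of the prime field;
both have degree at most `3 l < p`, so they are proportional as polynomials. At the root
`θ = (b / a) ^ p` of `t` neither `s` nor `r` vanishes, because `b / a` is not in the prime field.
So `w` vanishes at `θ` to order at least `l + ν > l`. This order is the total multiplicity of `W`
along the zeros of `B - θ A`, which is at most `l` since `l < p`
(`rootMultiplicity_pencilNorm_wronskian_le`): a contradiction (`pencil_residue_false`).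
-/

namespace LogForms

open Polynomial

/-! ### The product of a pencil over the prime field -/

theorem eval_ne_zero_or_of_isCoprime {k : Type*} [Field k] {A B : k[X]} (h : IsCoprime A B)
    (x : k) : A.eval x ≠ 0 ∨ B.eval x ≠ 0 := by
  by_contra! h0
  obtain ⟨u, v, huv⟩ := h
  have := congrArg (eval x) huv
  simp [h0.1, h0.2] at this

section Pencil

variable {k : Type*} [Field k] {p : ℕ} [Fact p.Prime] [CharP k p]

theorem prod_X_sub_C_natCast : ∏ n ∈ Finset.range p, (X - C (n : k)) = X ^ p - X := by
  have hp : 1 < p := (Fact.out : p.Prime).one_lt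
  have hinj : Set.InjOn (fun n : ℕ => (n : k)) (Finset.range p) := by
    intro a ha b hb hab
    rw [Finset.coe_range, Set.mem_Iio] at ha hb
    exact CharP.natCast_injOn_Iio k p ha hb hab
  have hdvd : ∏ n ∈ Finset.range p, (X - C (n : k)) ∣ X ^ p - X := by
    refine Finset.prod_dvd_of_coprime (fun a ha b hb hab => ?_) fun n _ => ?_
    · exact isCoprime_X_sub_C_of_isUnit_sub
        (sub_ne_zero.mpr fun h => hab (hinj ha hb h)).isUnit
    · rw [dvd_iff_isRoot, IsRoot.def, eval_sub, eval_pow, eval_X, sub_eq_zero]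
      exact map_natCast (frobenius k p) n
  refine (eq_of_monic_of_dvd_of_natDegree_le ?_ ?_ hdvd ?_).symm
  · exact monic_prod_of_monic _ _ fun n _ => monic_X_sub_C _
  · exact monic_X_pow_sub (by rw [degree_X]; exact_mod_cast hp)
  · rw [FiniteField.X_pow_card_sub_X_natDegree_eq k hp, natDegree_prod_of_monic _ _
      fun n _ => monic_X_sub_C _]
    simp only [natDegree_X_sub_C, Finset.sum_const, Finset.card_range, smul_eq_mul, mul_one,
      le_refl]

theorem exists_natCast_of_pow_eq_self {y : k} (h : y ^ p = y) : ∃ n < p, (n : k) = y := by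
  have := congrArg (eval y) (prod_X_sub_C_natCast (k := k) (p := p))
  simp only [eval_prod, eval_sub, eval_X, eval_C, eval_pow, h, sub_self,
    Finset.prod_eq_zero_iff, Finset.mem_range] at this
  obtain ⟨n, hn, h0⟩ := this
  exact ⟨n, hn, (sub_eq_zero.mp h0).symm⟩

/-- Homogeneous form of `∏ (X - n) = X ^ p - X`, the product being over the prime field. -/
theorem prod_sub_natCast_mul [Infinite k] (A B : k[X]) :
    ∏ n ∈ Finset.range p, (B - C (n : k) * A) = B ^ p - A ^ (p - 1) * B := by
  have hp : 0 < p := (Fact.out : p.Prime).pos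
  refine Polynomial.funext fun x => ?_
  simp only [eval_prod, eval_sub, eval_mul, eval_C, eval_pow]
  generalize eval x A = z
  generalize eval x B = y
  rcases eq_or_ne z 0 with rfl | hz
  · have : p - 1 ≠ 0 := by have := (Fact.out : p.Prime).two_le; omega
    simp [this]
  · have h := congrArg (eval (y / z)) (prod_X_sub_C_natCast (k := k) (p := p))
    simp only [eval_prod, eval_sub, eval_X, eval_C, eval_pow] at h
    have h2 : ∏ n ∈ Finset.range p, (y - n * z) =
        ∏ n ∈ Finset.range p, (z * (y / z - n)) :=
      Finset.prod_congr rfl fun n _ => by field_simp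
    rw [h2, Finset.prod_mul_distrib, h, Finset.prod_const, Finset.card_range, mul_sub,
      ← mul_pow, mul_div_cancel₀ _ hz, ← Nat.sub_add_cancel hp, pow_succ z]
    simp only [Nat.add_sub_cancel]
    field_simp

/-- In characteristic `p` only the factor `A ^ (p - 1)` and the last `B` contribute, which leaves
the Wronskian of `A` and `B`. -/
theorem derivative_pow_sub_pow_mul (A B : k[X]) :
    derivative (B ^ p - A ^ (p - 1) * B) =
      A ^ (p - 2) * (derivative A * B - A * derivative B) := by
  obtain ⟨q, hq⟩ : ∃ q, p = q + 2 := ⟨p - 2, by have := (Fact.out : p.Prime).two_le; omega⟩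
  have h0 : (p : k[X]) = 0 := CharP.cast_eq_zero _ p
  have h1 : ((q : k[X]) + 1) = -1 := by
    rw [hq] at h0; push_cast at h0; linear_combination h0
  have h2 : p - 1 = q + 1 := by omega
  have h3 : p - 2 = q := by omega
  rw [derivative_sub, derivative_mul, derivative_pow, derivative_pow, h2, h3]
  simp only [map_natCast, h0]
  push_cast
  rw [h1]
  ring

/-- Symmetry of the resultant, written as products of values over roots. -/
theorem norm_comm [IsAlgClosed k] (f g : k[X]) :
    f.leadingCoeff ^ g.natDegree * (f.roots.map g.eval).prod =
      (-1) ^ (f.natDegree * g.natDegree) *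
        (g.leadingCoeff ^ f.natDegree * (g.roots.map f.eval).prod) := by
  rw [← resultant_eq_prod_eval f g _ le_rfl (IsAlgClosed.splits f), resultant_comm,
    resultant_eq_prod_eval g f _ le_rfl (IsAlgClosed.splits g)]

end Pencil

/-! ### Ramification of the pencil -/

/-- If `L` has degree below the characteristic, differentiation lowers its multiplicity at a root
by exactly one, so a Wronskian with a function not vanishing there has smaller multiplicity. -/
theorem rootMultiplicity_wronskian_lt {k : Type*} [Field k] {p : ℕ} [CharP k p]
    {A L : k[X]} {c : k} (hL : L ≠ 0) (hdeg : L.natDegree < p)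
    (hW : derivative A * L - A * derivative L ≠ 0)
    (hA : A.eval c ≠ 0) (hc : L.eval c = 0) :
    (derivative A * L - A * derivative L).rootMultiplicity c < L.rootMultiplicity c := by
  have hpos : 0 < L.rootMultiplicity c := (rootMultiplicity_pos hL).2 hc
  have hle : L.rootMultiplicity c ≤ L.natDegree := by
    have := natDegree_le_of_dvd (pow_rootMultiplicity_dvd L c) hL
    simpa using this
  have hne : ((L.rootMultiplicity c : ℕ) : k) ≠ 0 := by
    rw [Ne, CharP.cast_eq_zero_iff k p]
    exact fun h => absurd (Nat.le_of_dvd hpos h) (by omega)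
  have hder := derivative_rootMultiplicity_of_root_of_mem_nonZeroDivisors
    (p := L) (t := c) hc (mem_nonZeroDivisors_of_ne_zero hne)
  by_contra! hlt
  have h1 : (X - C c) ^ L.rootMultiplicity c ∣ derivative A * L - A * derivative L :=
    (le_rootMultiplicity_iff hW).1 hlt
  have h2 : (X - C c) ^ L.rootMultiplicity c ∣ A * derivative L := by
    have := dvd_sub ((pow_rootMultiplicity_dvd L c).mul_left (derivative A)) h1
    rwa [sub_sub_cancel] at this
  have hcop : IsCoprime ((X - C c) ^ L.rootMultiplicity c) A := by
    refine IsCoprime.pow_left ?_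
    refine ((irreducible_X_sub_C c).coprime_iff_not_dvd).2 ?_
    rwa [dvd_iff_isRoot]
  have h3 := hcop.dvd_of_dvd_mul_left h2
  have h0 : derivative L ≠ 0 := by
    intro h0
    obtain ⟨S, hS⟩ := pow_rootMultiplicity_dvd L c
    rw [h0] at hder
    -- the multiplicity formula for `L' = 0` leaves only a simple root, where `L'` cannot vanish
    have hm : L.rootMultiplicity c = 1 := by
      rw [rootMultiplicity_zero] at hder; omega
    rw [hm, pow_one] at hS
    have := congrArg (fun q => (derivative q).eval c) hS
    simp only [h0, eval_zero, derivative_mul, derivative_X_sub_C, one_mul, eval_add, eval_mul,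
      eval_sub, eval_X, eval_C, sub_self, zero_mul, add_zero] at this
    have h4 : (X - C c) ∣ S := dvd_iff_isRoot.2 this.symm
    have h5 : (X - C c) ^ 2 ∣ L := by
      rw [hS, pow_two]; exact mul_dvd_mul_left _ h4
    have := (le_rootMultiplicity_iff hL).2 h5
    omega
  have := (le_rootMultiplicity_iff h0).2 h3
  omega

section Norm

variable {k : Type*} [Field k]

/-- The product over the roots `c` of `W`, with multiplicity, of `B(c) - z A(c)`, as a polynomial
in `z`. Up to a constant it is the resultant of `B - z A` and `W`. -/
noncomputable def pencilNorm (A B W : k[X]) : k[X] :=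
  (W.roots.map fun c => C (B.eval c) - X * C (A.eval c)).prod

theorem eval_pencilNorm (A B W : k[X]) (z : k) :
    (pencilNorm A B W).eval z = (W.roots.map (B - C z * A).eval).prod := by
  rw [pencilNorm, eval_multiset_prod, Multiset.map_map]
  simp only [Function.comp_def, eval_sub, eval_mul, eval_C, eval_X, mul_comm z]

theorem natDegree_pencilNorm_le (A B W : k[X]) :
    (pencilNorm A B W).natDegree ≤ W.natDegree := by
  refine (natDegree_multiset_prod_le _).trans ?_
  rw [Multiset.map_map]
  refine (Multiset.sum_le_card_nsmul _ 1 ?_).trans ?_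
  · intro x hx
    obtain ⟨c, -, rfl⟩ := Multiset.mem_map.1 hx
    simp only [Function.comp_apply]
    compute_degree
  · simpa using card_roots' W

open Classical in
/-- Coprimality makes every factor `B(c) - z A(c)` nonzero in `z`; a factor with `A(c) = 0` is a
constant and contributes no root. -/
theorem rootMultiplicity_pencilNorm {A B W : k[X]} (hAB : IsCoprime A B) (θ : k) :
    (pencilNorm A B W).rootMultiplicity θ =
      Multiset.card (W.roots.filter fun c => (B - C θ * A).eval c = 0) := by
  have hne := eval_ne_zero_or_of_isCoprime hAB
  have hne' : ∀ c, C (B.eval c) - X * C (A.eval c) ≠ 0 := by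
    intro c h
    have h0 := congrArg (Polynomial.coeff · 0) h
    have h1 := congrArg (Polynomial.coeff · 1) h
    simp [coeff_C] at h0 h1
    rcases hne c with h | h <;> contradiction
  have hroot : ∀ c, (C (B.eval c) - X * C (A.eval c)).rootMultiplicity θ =
      if (B - C θ * A).eval c = 0 then 1 else 0 := by
    intro c
    split_ifs with h
    · simp only [eval_sub, eval_mul, eval_C, sub_eq_zero] at h
      have hA : A.eval c ≠ 0 := by
        intro hA
        rw [hA, mul_zero] at h
        rcases hne c with h' | h' <;> contradiction
      have : C (B.eval c) - X * C (A.eval c) = C (-A.eval c) * (X - C θ) := by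
        rw [h]; simp only [C_mul, C_neg]; ring
      rw [this, rootMultiplicity_mul (mul_ne_zero (C_ne_zero.2 (neg_ne_zero.2 hA))
        (X_sub_C_ne_zero θ)), rootMultiplicity_C, rootMultiplicity_X_sub_C_self]
    · refine rootMultiplicity_eq_zero ?_
      simpa only [IsRoot.def, eval_sub, eval_mul, eval_C, eval_X, mul_comm θ] using h
  have key : ∀ s : Multiset k,
      (s.map fun c => C (B.eval c) - X * C (A.eval c)).prod.rootMultiplicity θ =
        Multiset.card (s.filter fun c => (B - C θ * A).eval c = 0) := by
    intro s
    induction s using Multiset.induction_on with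
    | empty => simp
    | cons c s ih =>
      rw [Multiset.map_cons, Multiset.prod_cons, rootMultiplicity_mul, ih, hroot]
      · by_cases h : (B - C θ * A).eval c = 0
        · rw [Multiset.filter_cons_of_pos (p := fun c => (B - C θ * A).eval c = 0) _ h,
            if_pos h, Multiset.card_cons, add_comm]
        · rw [Multiset.filter_cons_of_neg (p := fun c => (B - C θ * A).eval c = 0) _ h,
            if_neg h, zero_add]
      · refine mul_ne_zero (hne' c) (Multiset.prod_ne_zero fun h0 => ?_)
        obtain ⟨c', -, h'⟩ := Multiset.mem_map.1 h0
        exact hne' c' h'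
  exact key _

/-- Ramification bound: the Wronskian vanishes along the zeros of `B - θ A` to a total order at most
the degree of this polynomial, because it is also the Wronskian of `A` and `B - θ A`. -/
theorem rootMultiplicity_pencilNorm_wronskian_le {p : ℕ} [CharP k p] {A B : k[X]}
    (hAB : IsCoprime A B) (hW : derivative A * B - A * derivative B ≠ 0) (θ : k)
    (hdeg : (B - C θ * A).natDegree < p) :
    (pencilNorm A B (derivative A * B - A * derivative B)).rootMultiplicity θ ≤
      (B - C θ * A).natDegree := by
  classical
  set L := B - C θ * A with hLdef
  have hWL : derivative A * B - A * derivative B = derivative A * L - A * derivative L := by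
    rw [hLdef]; simp only [derivative_sub, derivative_mul, derivative_C]; ring
  have hL : L ≠ 0 := by
    intro h
    rw [h] at hWL
    exact hW (by simpa using hWL)
  rw [rootMultiplicity_pencilNorm hAB]
  refine le_trans (Multiset.card_le_card ?_) (card_roots' L)
  rw [Multiset.le_iff_count]
  intro c
  rw [Multiset.count_filter]
  split_ifs with h
  · rw [count_roots, count_roots, hWL]
    refine (rootMultiplicity_wronskian_lt hL hdeg (hWL ▸ hW) ?_ h).le
    intro hA
    have hB : B.eval c = 0 := by simpa [hLdef, hA] using h
    exact (eval_ne_zero_or_of_isCoprime hAB c).elim (· hA) (· hB)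
  · exact Nat.zero_le _

end Norm

/-! ### Norms of residues along the fibres -/

/-- A pencil of degree `l < p / 3` cannot have the residues `γ / (A ^ (p - 2) W)` in the prime
field on all its fibres over the prime field, `W` being the Wronskian. The product of the residues
over the fibre over `n` is `κ₂ t(n) ^ l / (κ₁ w(n) s(n) ^ ν)`, where `s(n) = b - n a` is the leading
coefficient of the fibre, `t(n) = s(n) ^ p`, and `w` is the `pencilNorm` of the Wronskian. Being in
the prime field, it is fixed by the Frobenius. -/
theorem pencil_residue_false {k : Type*} [Field k] [IsAlgClosed k] {p : ℕ} [Fact p.Prime]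
    [CharP k p] {l : ℕ} (hl : 0 < l) (hp : 3 * l < p) {A B : k[X]} (hAB : IsCoprime A B)
    (hA : A.natDegree = l) (hdeg : ∀ n : ℕ, (B - C (n : k) * A).natDegree = l)
    {γ : k} (hγ : γ ≠ 0)
    (hres : ∀ (n : ℕ) (x : k), (B - C (n : k) * A).eval x = 0 → ∃ m : ℕ,
      (m : k) * (A.eval x ^ (p - 2) * (derivative A * B - A * derivative B).eval x) = γ) :
    False := by
  classical
  have hp0 : 0 < p := by omega
  set W := derivative A * B - A * derivative B with hWdef
  set a := A.leadingCoeff with ha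
  have ha0 : a ≠ 0 := by
    rw [ha, leadingCoeff_ne_zero]; rintro rfl; simp at hA; omega
  set b := B.coeff l with hb
  have hac : A.coeff l = a := by rw [ha, leadingCoeff, hA]
  have hlc : ∀ n : ℕ, (B - C (n : k) * A).leadingCoeff = b - n * a := by
    intro n
    rw [leadingCoeff, hdeg n, coeff_sub, coeff_C_mul, hac]
  have hQ0 : ∀ n : ℕ, B - C (n : k) * A ≠ 0 := by
    intro n h
    have := hdeg n
    rw [h, natDegree_zero] at this
    omega
  have hs0 : ∀ n : ℕ, b - n * a ≠ 0 := fun n => by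
    rw [← hlc n, leadingCoeff_ne_zero]; exact hQ0 n
  -- the Wronskian does not vanish, since the fibre over `0` has a point
  have hW0 : W ≠ 0 := by
    intro h0
    obtain ⟨x, hx⟩ := IsAlgClosed.exists_root (B - C ((0 : ℕ) : k) * A) (by
      rw [degree_eq_natDegree (hQ0 0), hdeg 0]; exact_mod_cast hl.ne')
    obtain ⟨m, hm⟩ := hres 0 x hx
    rw [h0, eval_zero, mul_zero, mul_zero] at hm
    exact hγ hm.symm
  have hBdeg : B.natDegree = l := by simpa using hdeg 0
  have hWdeg : W.natDegree ≤ 2 * l - 1 := by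
    refine (natDegree_sub_le _ _).trans (max_le ?_ ?_)
    · refine natDegree_mul_le.trans ?_
      have := natDegree_derivative_le A
      omega
    · refine natDegree_mul_le.trans ?_
      have := natDegree_derivative_le B
      omega
  -- `ν ≥ 1` because a Wronskian has degree below `2 l`
  obtain ⟨ν, hν⟩ : ∃ ν, W.natDegree + ν = 2 * l := ⟨2 * l - W.natDegree, by omega⟩
  have hν1 : 1 ≤ ν := by omega
  set d := W.natDegree with hd
  set w := pencilNorm A B W with hw
  -- the norm of `A` along the fibre over `n`: at the roots of `A` the fibre polynomials all agree
  -- with `B`, so the resultant is independent of `n`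
  obtain ⟨ρ, hρ0, hρ⟩ : ∃ ρ : k, ρ ≠ 0 ∧ ∀ n : ℕ,
      (b - n * a) ^ l * ((B - C (n : k) * A).roots.map A.eval).prod = ρ := by
    refine ⟨(-1) ^ (l * l) * (a ^ l * (A.roots.map B.eval).prod), ?_, fun n => ?_⟩
    · refine mul_ne_zero (pow_ne_zero _ (by simp)) (mul_ne_zero (pow_ne_zero _ ha0)
        (Multiset.prod_ne_zero fun h => ?_))
      obtain ⟨x, hx, hBx⟩ := Multiset.mem_map.1 h
      exact (eval_ne_zero_or_of_isCoprime hAB x).elim (· (mem_roots'.1 hx).2) (· hBx)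
    · have h := norm_comm (B - C (n : k) * A) A
      rw [hlc, hA, hdeg n, ← ha] at h
      rw [h]
      congr 3
      refine Multiset.map_congr rfl fun x hx => ?_
      have hAx : A.eval x = 0 := (mem_roots'.1 hx).2
      simp [hAx]
  -- the norm of the Wronskian along the fibre over `n`
  obtain ⟨ρ', hρ'0, hρ'⟩ : ∃ ρ' : k, ρ' ≠ 0 ∧ ∀ n : ℕ,
      (b - n * a) ^ d * ((B - C (n : k) * A).roots.map W.eval).prod = ρ' * w.eval (n : k) := by
    refine ⟨(-1) ^ (l * d) * W.leadingCoeff ^ l, mul_ne_zero (pow_ne_zero _ (by simp))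
      (pow_ne_zero _ (leadingCoeff_ne_zero.2 hW0)), fun n => ?_⟩
    have h := norm_comm (B - C (n : k) * A) W
    rw [hlc, hdeg n, ← hd] at h
    rw [h, hw, eval_pencilNorm, mul_assoc]
  -- the product of the residues along the fibre over `n`
  have hH : ∀ n : ℕ, ∃ H : ℕ, (H : k) * (ρ ^ (p - 2) * ρ') * w.eval (n : k) * (b - n * a) ^ ν =
      γ ^ l * (b - n * a) ^ (l * p) := by
    intro n
    set Q := B - C (n : k) * A with hQ
    have hroots : ∀ x ∈ Q.roots, ∃ m : ℕ, (m : k) * (A.eval x ^ (p - 2) * W.eval x) = γ :=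
      fun x hx => hres n x (mem_roots'.1 hx).2
    choose! m hm using hroots
    have hcard : Multiset.card Q.roots = l := by
      rw [← hdeg n]; exact (IsAlgClosed.splits Q).natDegree_eq_card_roots.symm
    have hprod : ((Q.roots.map m).prod : k) *
        ((Q.roots.map A.eval).prod ^ (p - 2) * (Q.roots.map W.eval).prod) = γ ^ l := by
      have hγl : γ ^ l = (Q.roots.map fun _ => γ).prod := by
        rw [Multiset.map_const', Multiset.prod_replicate, hcard]
      rw [hγl, ← Multiset.prod_map_pow, ← Multiset.prod_map_mul, Nat.cast_multiset_prod,
        Multiset.map_map, ← Multiset.prod_map_mul]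
      exact congrArg _ (Multiset.map_congr rfl fun x hx => by simpa using hm x hx)
    refine ⟨(Q.roots.map m).prod, ?_⟩
    have e : l * p = l * (p - 2) + d + ν := by
      obtain ⟨q, rfl⟩ : ∃ q, p = q + 2 := ⟨p - 2, by omega⟩
      rw [Nat.add_sub_cancel, add_assoc, hν]; ring
    rw [← hprod, e, pow_add, pow_add, pow_mul]
    have e1 : ρ ^ (p - 2) * (ρ' * w.eval (n : k)) =
        ((b - n * a) ^ l) ^ (p - 2) * (Q.roots.map A.eval).prod ^ (p - 2) *
          ((b - n * a) ^ d * (Q.roots.map W.eval).prod) := by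
      rw [← hρ n, ← hρ' n, mul_pow]
    linear_combination ((Q.roots.map m).prod : k) * (b - n * a) ^ ν * e1
  set κ₁ := ρ ^ (p - 2) * ρ' with hκ₁
  set κ₂ := γ ^ l with hκ₂
  have hκ₁0 : κ₁ ≠ 0 := mul_ne_zero (pow_ne_zero _ hρ0) hρ'0
  have hκ₂0 : κ₂ ≠ 0 := pow_ne_zero _ hγ
  have hw0 : w ≠ 0 := by
    intro h0
    obtain ⟨H, hH⟩ := hH 0
    rw [h0, eval_zero, mul_zero, zero_mul] at hH
    exact mul_ne_zero hκ₂0 (pow_ne_zero _ (hs0 0)) hH.symm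
  have hfrob : ∀ (x y : k) (n : ℕ), (x - n * y) ^ p = x ^ p - n * y ^ p := by
    intro x y n
    rw [sub_pow_char, mul_pow]
    congr 2
    exact map_natCast (frobenius k p) n
  have hnat : ∀ n : ℕ, (n : k) ^ p = n := fun n => map_natCast (frobenius k p) n
  -- on the prime field the `p`-th power of `s` is `t`, and that of `t` is `r`
  let s : k[X] := C b - X * C a
  let t : k[X] := C (b ^ p) - X * C (a ^ p)
  let r : k[X] := C ((b ^ p) ^ p) - X * C ((a ^ p) ^ p)
  have hsdeg : s.natDegree ≤ 1 := by simp only [s]; compute_degree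
  have htdeg : t.natDegree ≤ 1 := by simp only [t]; compute_degree
  have hrdeg : r.natDegree ≤ 1 := by simp only [r]; compute_degree
  have hwdeg : w.natDegree ≤ d := natDegree_pencilNorm_le A B W
  set wσ := w.map (frobenius k p) with hwσ
  have hwσdeg : wσ.natDegree ≤ d := natDegree_map_le.trans hwdeg
  -- both sides have degree at most `3 l < p` and they agree on the prime field
  have hid : C (κ₂ ^ p * κ₁) * (r ^ l * (w * s ^ ν)) = C (κ₁ ^ p * κ₂) * (wσ * t ^ (l + ν)) := by
    rw [← sub_eq_zero]
    refine eq_zero_of_natDegree_lt_card_of_eval_eq_zero' _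
      ((Finset.range p).image fun n : ℕ => (n : k)) ?_ ?_
    · intro z hz
      obtain ⟨n, -, rfl⟩ := Finset.mem_image.1 hz
      obtain ⟨H, hH⟩ := hH n
      have es : s.eval (n : k) = b - n * a := by
        simp only [s, eval_sub, eval_mul, eval_C, eval_X]
      have et : t.eval (n : k) = (b - n * a) ^ p := by rw [hfrob]; simp [t]
      have er : r.eval (n : k) = ((b - n * a) ^ p) ^ p := by rw [hfrob, hfrob]; simp [r]
      have ew : wσ.eval (n : k) = (w.eval (n : k)) ^ p := by
        have := eval_map_apply (frobenius k p) (p := w) (n : k)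
        rw [map_natCast] at this
        exact this
      have hHp := congrArg (· ^ p) hH
      simp only [mul_pow, hnat] at hHp
      simp only [eval_sub, eval_mul, eval_C, eval_pow, es, et, er, ew]
      have e1 : ((b - n * a) ^ (l * p)) = ((b - n * a) ^ p) ^ l := by
        rw [mul_comm l, pow_mul]
      have e2 : ((b - n * a) ^ (l * p)) ^ p = (((b - n * a) ^ p) ^ p) ^ l := by
        rw [e1, pow_right_comm]
      have e3 : ((b - n * a) ^ ν) ^ p = ((b - n * a) ^ p) ^ ν := pow_right_comm _ _ _
      rw [e2, e3] at hHp
      rw [e1] at hH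
      rw [pow_add]
      linear_combination (-κ₁ * w.eval (n : k) * (b - n * a) ^ ν) * hHp +
        κ₁ ^ p * w.eval (n : k) ^ p * ((b - n * a) ^ p) ^ ν * hH
    · have hinj : Set.InjOn (fun n : ℕ => (n : k)) (Finset.range p) := by
        intro x hx y hy hxy
        rw [Finset.coe_range] at hx hy
        exact CharP.natCast_injOn_Iio k p hx hy hxy
      rw [Finset.card_image_of_injOn hinj, Finset.card_range]
      refine lt_of_le_of_lt ((natDegree_sub_le _ _).trans (max_le ?_ ?_)) hp
      · refine (natDegree_C_mul_le _ _).trans (natDegree_mul_le.trans ?_)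
        have h1 := natDegree_pow_le_of_le l hrdeg
        have h2 := natDegree_mul_le (p := w) (q := s ^ ν)
        have h3 := natDegree_pow_le_of_le ν hsdeg
        omega
      · refine (natDegree_C_mul_le _ _).trans (natDegree_mul_le.trans ?_)
        have h1 := natDegree_pow_le_of_le (l + ν) htdeg
        omega
  -- the root of `t` is the Frobenius image of `b / a`
  set θ := (b / a) ^ p with hθ
  have hθnat : θ ≠ b / a := by
    intro h
    obtain ⟨n, -, hn⟩ := exists_natCast_of_pow_eq_self (hθ ▸ h)
    exact hs0 n (by rw [hn, div_mul_cancel₀ _ ha0, sub_self])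
  have hsθ : s.eval θ ≠ 0 := by
    intro h
    simp only [s, eval_sub, eval_C, eval_mul, eval_X, sub_eq_zero] at h
    exact hθnat (by rw [h, mul_div_cancel_right₀ _ ha0])
  have hrθ : r.eval θ ≠ 0 := by
    intro h
    simp only [r, eval_sub, eval_C, eval_mul, eval_X, sub_eq_zero] at h
    have h' : θ = ((b / a) ^ p) ^ p := by
      rw [div_pow, div_pow, eq_div_iff (pow_ne_zero _ (pow_ne_zero _ ha0)), h]
    exact hθnat (frobenius_inj k p h'.symm)
  have htdvd : (X - C θ) ∣ t := by
    rw [dvd_iff_isRoot]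
    simp [t, hθ, div_pow, div_mul_cancel₀ _ (pow_ne_zero p ha0)]
  -- at `θ` neither `r` nor `s` vanishes, so the zeros of the power of `t` all come from `w`
  have hdvd : (X - C θ) ^ (l + ν) ∣ w := by
    have h1 : (X - C θ) ^ (l + ν) ∣ C (κ₂ ^ p * κ₁) * (r ^ l * (w * s ^ ν)) := by
      rw [hid]
      exact ((pow_dvd_pow_of_dvd htdvd _).mul_left _).mul_left _
    have hcop : ∀ q : k[X], q.eval θ ≠ 0 → IsCoprime ((X - C θ) ^ (l + ν)) q := fun q hq =>
      (((irreducible_X_sub_C θ).coprime_iff_not_dvd).2 (by rwa [dvd_iff_isRoot])).pow_left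
    have h2 := (hcop (C (κ₂ ^ p * κ₁)) (by
      rw [eval_C]; exact mul_ne_zero (pow_ne_zero _ hκ₂0) hκ₁0)).dvd_of_dvd_mul_left h1
    have h3 := ((hcop r hrθ).pow_right).dvd_of_dvd_mul_left h2
    exact ((hcop s hsθ).pow_right).dvd_of_dvd_mul_right h3
  have h1 : l + ν ≤ w.rootMultiplicity θ := (le_rootMultiplicity_iff hw0).2 hdvd
  have hLdeg : (B - C θ * A).natDegree ≤ l :=
    (natDegree_sub_le _ _).trans (max_le hBdeg.le ((natDegree_C_mul_le _ _).trans hA.le))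
  have h2 := rootMultiplicity_pencilNorm_wronskian_le (p := p) hAB hW0 θ (by omega)
  have h3 : w.rootMultiplicity θ ≤ (B - C θ * A).natDegree := h2
  omega

/-! ### Logarithmic forms without finite zeros -/

section LocalData

variable {k : Type*} [Field k]

theorem D_algebraMap (T : k[X]) :
    KaehlerDifferential.D k (RatFunc k) (algebraMap k[X] (RatFunc k) T) =
      algebraMap k[X] (RatFunc k) (derivative T) • dX k := by
  have h := (KaehlerDifferential.D k (RatFunc k)).comp_aeval_eq RatFunc.X T
  have e : ∀ q : k[X], aeval (RatFunc.X : RatFunc k) q = algebraMap k[X] (RatFunc k) q := by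
    intro q
    induction q using Polynomial.induction_on' with
    | add a b ha hb => rw [map_add, map_add, ha, hb]
    | monomial n a =>
      rw [aeval_monomial, ← C_mul_X_pow_eq_monomial, map_mul, map_pow, RatFunc.algebraMap_X,
        RatFunc.algebraMap_C]
      rfl
  rwa [e, e] at h

/-- Multiplying `F` by the `p`-th power of its denominator does not change `dF / F`, so a
logarithmic form is the logarithmic derivative of a polynomial. -/
theorem IsLogarithmic.exists_polynomial {p : ℕ} [Fact p.Prime] [CharP k p] {ω : MeroForm k}
    (h : IsLogarithmic ω) : ∃ T : k[X], T ≠ 0 ∧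
      algebraMap k[X] (RatFunc k) T * coeff ω = algebraMap k[X] (RatFunc k) (derivative T) := by
  obtain ⟨F, hF, rfl⟩ := h
  have hp : 0 < p := (Fact.out : p.Prime).pos
  have hM0 : F.denom ≠ 0 := F.denom_ne_zero
  have hM : algebraMap k[X] (RatFunc k) F.denom ≠ 0 := RatFunc.algebraMap_ne_zero hM0
  have hp0 : (p : RatFunc k) = 0 := by
    rw [← map_natCast (algebraMap k (RatFunc k)), CharP.cast_eq_zero, map_zero]
  have hT : algebraMap k[X] (RatFunc k) (F.num * F.denom ^ (p - 1)) =
      F * algebraMap k[X] (RatFunc k) F.denom ^ p := by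
    rw [map_mul, map_pow, (div_eq_iff hM).1 F.num_div_denom, mul_assoc, ← pow_succ',
      Nat.sub_add_cancel hp]
  refine ⟨F.num * F.denom ^ (p - 1), mul_ne_zero (RatFunc.num_ne_zero hF) (pow_ne_zero _ hM0), ?_⟩
  have hD := D_algebraMap (F.num * F.denom ^ (p - 1))
  rw [hT, Derivation.leibniz, Derivation.leibniz_pow, ← Nat.cast_smul_eq_nsmul (RatFunc k) p,
    hp0, zero_smul, smul_zero, zero_add] at hD
  rw [← coeff_unique (algebraMap k[X] (RatFunc k) (derivative _)), ← hD, hT]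
  obtain ⟨g, hg⟩ : ∃ g : RatFunc k, KaehlerDifferential.D k (RatFunc k) F = g • dX k :=
    ⟨_, (coeff_smul_dX _).symm⟩
  rw [hg, smul_smul, smul_smul, coeff_unique, coeff_unique]
  field_simp

/-- The residue of `u / P` at a zero `x` of `P` is the multiplicity of `x` in `T` when
`u / P = T' / T`. -/
theorem exists_natCast_mul_derivative_eval {T P : k[X]} {u x : k} (hT : T ≠ 0)
    (h : C u * T = derivative T * P) (hx : P.eval x = 0) :
    ∃ m : ℕ, (m : k) * (derivative P).eval x = u := by
  obtain ⟨S, hTS, hS⟩ := exists_eq_pow_rootMultiplicity_mul_and_not_dvd T hT x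
  set m := T.rootMultiplicity x
  obtain ⟨P₁, rfl⟩ := dvd_iff_isRoot.2 hx
  refine ⟨m, ?_⟩
  have hS0 : S.eval x ≠ 0 := fun h0 => hS (dvd_iff_isRoot.2 h0)
  have hd : derivative T * (X - C x) =
      (X - C x) ^ m * (C (m : k) * S + (X - C x) * derivative S) := by
    rw [hTS, derivative_mul, derivative_X_sub_C_pow]
    rcases Nat.eq_zero_or_pos m with hm | hm
    · rw [hm]; simp; ring
    · conv_rhs => rw [← Nat.sub_add_cancel hm, pow_succ]
      conv_lhs => enter [1, 2, 1]; rw [← Nat.sub_add_cancel hm, pow_succ]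
      rw [Nat.sub_add_cancel hm]
      ring
  have h2 : C u * S = (C (m : k) * S + (X - C x) * derivative S) * P₁ := by
    refine mul_left_cancel₀ (pow_ne_zero m (X_sub_C_ne_zero x)) ?_
    linear_combination h + P₁ * hd - C u * hTS
  have h3 := congrArg (eval x) h2
  simp only [eval_mul, eval_C, eval_add, eval_sub, eval_X, sub_self, zero_mul, add_zero] at h3
  simp only [derivative_mul, derivative_X_sub_C, one_mul, eval_add, eval_mul, eval_sub, eval_X,
    eval_C, sub_self, zero_mul, add_zero]
  exact mul_right_cancel₀ hS0 (by linear_combination -h3)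

/-- A nonzero form in the space is `u dX / P` with `u` constant and `P` of degree `N`; its
residues `u / P'(x)` are images of natural numbers, so in particular its poles are simple. -/
theorem IsSpaceL.exists_denominator [IsAlgClosed k] {p : ℕ} [Fact p.Prime] [CharP k p]
    [Algebra (ZMod p) k] {N n : ℕ} {Ω : Submodule (ZMod p) (MeroForm k)} (hΩ : IsSpaceL p N n Ω)
    {ω : MeroForm k} (hω : ω ∈ Ω) (h0 : ω ≠ 0) :
    ∃ (u : k) (P : k[X]), u ≠ 0 ∧ P ≠ 0 ∧ P.natDegree = N ∧
      coeff ω * algebraMap k[X] (RatFunc k) P = algebraMap k[X] (RatFunc k) (C u) ∧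
      ∀ x, P.eval x = 0 → ∃ m : ℕ, (m : k) * (derivative P).eval x = u := by
  set f := coeff ω with hf
  have hf0 : f ≠ 0 := by
    intro h
    rw [← coeff_smul_dX ω, ← hf, h, zero_smul] at h0
    exact h0 rfl
  have hnum : f.num.natDegree = 0 := by
    by_contra hdeg
    obtain ⟨x, hx⟩ := IsAlgClosed.exists_root f.num
      (fun h => hdeg (natDegree_eq_of_degree_eq_some h))
    have hden : f.denom.eval x ≠ 0 := by
      intro hd
      exact (eval_ne_zero_or_of_isCoprime f.isCoprime_num_denom x).elim (· hx) (· hd)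
    refine hΩ.not_zero_finite ω hω h0 x ?_
    have h1 : 0 < f.num.rootMultiplicity x :=
      (rootMultiplicity_pos (RatFunc.num_ne_zero hf0)).2 hx
    have h2 : f.denom.rootMultiplicity x = 0 := rootMultiplicity_eq_zero hden
    change (0 : ℤ) < (f.num.rootMultiplicity x : ℤ) - (f.denom.rootMultiplicity x : ℤ)
    omega
  obtain ⟨u, hu⟩ : ∃ u, f.num = C u := ⟨_, eq_C_of_natDegree_eq_zero hnum⟩
  have hu0 : u ≠ 0 := by
    rintro rfl
    exact RatFunc.num_ne_zero hf0 (by simpa using hu)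
  have hfP : f * algebraMap k[X] (RatFunc k) f.denom = algebraMap k[X] (RatFunc k) (C u) := by
    rw [← hu]
    conv_lhs => enter [1]; rw [← f.num_div_denom]
    exact div_mul_cancel₀ _ (RatFunc.algebraMap_ne_zero f.denom_ne_zero)
  refine ⟨u, f.denom, hu0, f.denom_ne_zero, ?_, hfP, fun x hx => ?_⟩
  · have h1 : -f.intDegree - 2 = (N : ℤ) - 2 := hΩ.ordAt_infty ω hω h0
    rw [RatFunc.intDegree, hnum] at h1
    omega
  · obtain ⟨T, hT0, hT⟩ := (hΩ.isLogarithmic ω hω h0).exists_polynomial (p := p)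
    refine exists_natCast_mul_derivative_eval hT0 ?_ hx
    refine RatFunc.algebraMap_injective k ?_
    rw [map_mul, map_mul, ← hT, ← hfP]
    ring

theorem coeff_sub_nsmul (ω ω' : MeroForm k) (n : ℕ) :
    coeff (ω' - n • ω) = coeff ω' - n * coeff ω := by
  conv_lhs => rw [← coeff_smul_dX ω, ← coeff_smul_dX ω']
  rw [← Nat.cast_smul_eq_nsmul (RatFunc k), smul_smul, ← sub_smul, coeff_unique]

end LocalData

theorem dvd_of_simple_roots {k : Type*} [Field k] [IsAlgClosed k] {P D : k[X]} (hP : P ≠ 0)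
    (hD : D ≠ 0)
    (h : ∀ x, P.eval x = 0 → (derivative P).eval x ≠ 0 ∧ D.eval x = 0) : P ∣ D := by
  classical
  refine (IsAlgClosed.splits P).dvd_of_roots_le_roots hP ?_
  rw [Multiset.le_iff_subset]
  · intro x hx
    exact (mem_roots hD).2 (h x (mem_roots'.1 hx).2).2
  · rw [Multiset.nodup_iff_count_le_one]
    intro x
    rw [count_roots]
    by_contra! h1
    have := (one_lt_rootMultiplicity_iff_isRoot hP).1 h1
    exact (h x this.1).1 this.2

/-! ### The pencil attached to a two-dimensional space -/

/-- Two forms `u₁ dX / P₁` and `u₂ dX / P₂` spanning the space define the pencil of `A = u₁ a` and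
`B = u₂ b`, where `P₁ = G b` and `P₂ = G a` with `a`, `b` coprime. The poles of the first form are
exactly the zeros of `B ^ p - A ^ (p - 1) B`, the product of the fibres over the prime field, and
the derivative of this product turns residues into values of `A ^ (p - 2)` times the Wronskian.
The hypothesis `hpen` says that each combination `u₂ / P₂ - n u₁ / P₁` is again a constant `v`
over a polynomial `R` of degree `l p`. -/
theorem pencil_of_residues {k : Type*} [Field k] [IsAlgClosed k] {p : ℕ} [Fact p.Prime]
    [CharP k p] {l : ℕ} {u₁ u₂ : k} {P₁ P₂ : k[X]} (hu₁ : u₁ ≠ 0)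
    (hu₂ : u₂ ≠ 0) (hP₁ : P₁ ≠ 0) (hP₂ : P₂ ≠ 0) (hd₁ : P₁.natDegree = l * p)
    (hr₁ : ∀ x, P₁.eval x = 0 → ∃ m : ℕ, (m : k) * (derivative P₁).eval x = u₁)
    (hr₂ : ∀ x, P₂.eval x = 0 → ∃ m : ℕ, (m : k) * (derivative P₂).eval x = u₂)
    (hpen : ∀ n : ℕ, ∃ (v : k) (R : k[X]), v ≠ 0 ∧ R ≠ 0 ∧ R.natDegree = l * p ∧
      R * (C u₂ * P₁ - C (n : k) * (C u₁ * P₂)) = C v * (P₁ * P₂)) :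
    ∃ (A B : k[X]) (γ : k), IsCoprime A B ∧ A.natDegree = l ∧ γ ≠ 0 ∧
      (∀ n : ℕ, (B - C (n : k) * A).natDegree = l) ∧
      ∀ (n : ℕ) (x : k), (B - C (n : k) * A).eval x = 0 → ∃ m : ℕ,
        (m : k) * (A.eval x ^ (p - 2) * (derivative A * B - A * derivative B).eval x) = γ := by
  classical
  have hp0 : 0 < p := (Fact.out : p.Prime).pos
  obtain ⟨G, b, a, hcop, hPb, hPa⟩ : ∃ G b a : k[X], IsCoprime a b ∧ P₁ = G * b ∧ P₂ = G * a := by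
    obtain ⟨b, hb⟩ := EuclideanDomain.gcd_dvd_left P₁ P₂
    obtain ⟨a, ha⟩ := EuclideanDomain.gcd_dvd_right P₁ P₂
    refine ⟨EuclideanDomain.gcd P₁ P₂, b, a, ?_, hb, ha⟩
    have hG : EuclideanDomain.gcd P₁ P₂ ≠ 0 := fun h => hP₁ (by rw [hb, h, zero_mul])
    refine ⟨EuclideanDomain.gcdB P₁ P₂, EuclideanDomain.gcdA P₁ P₂, mul_left_cancel₀ hG ?_⟩
    have := EuclideanDomain.gcd_eq_gcd_ab P₁ P₂
    linear_combination -this - EuclideanDomain.gcdA P₁ P₂ * hb - EuclideanDomain.gcdB P₁ P₂ * ha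
  subst hPb hPa
  have hG : G ≠ 0 := left_ne_zero_of_mul hP₁
  have hb : b ≠ 0 := right_ne_zero_of_mul hP₁
  have ha : a ≠ 0 := right_ne_zero_of_mul hP₂
  have hC₁ : IsUnit (C u₁) := isUnit_C.2 hu₁.isUnit
  have hC₂ : IsUnit (C u₂) := isUnit_C.2 hu₂.isUnit
  set A := C u₁ * a with hA
  set B := C u₂ * b with hB
  have hAB : IsCoprime A B :=
    (isCoprime_mul_unit_left_left hC₁ _ _).2 ((isCoprime_mul_unit_left_right hC₂ _ _).2 hcop)
  have hfib : ∀ n : ℕ, ∃ (v : k) (R : k[X]), v ≠ 0 ∧ R ≠ 0 ∧ R.natDegree = l * p ∧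
      R * (B - C (n : k) * A) = C v * (G * b * a) := by
    intro n
    obtain ⟨v, R, hv, hR0, hR, h⟩ := hpen n
    refine ⟨v, R, hv, hR0, hR, mul_left_cancel₀ hG ?_⟩
    rw [hA, hB]
    linear_combination h
  have hQ0 : ∀ n : ℕ, B - C (n : k) * A ≠ 0 := by
    intro n h0
    obtain ⟨v, R, hv, -, -, h⟩ := hfib n
    rw [h0, mul_zero] at h
    exact mul_ne_zero (C_ne_zero.2 hv) (mul_ne_zero (mul_ne_zero hG hb) ha) h.symm
  -- compare degrees in `hfib`: `R` and `G * b` both have degree `l p`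
  have hQdeg : ∀ n : ℕ, (B - C (n : k) * A).natDegree = a.natDegree := by
    intro n
    obtain ⟨v, R, hv, hR0, hR, h⟩ := hfib n
    have := congrArg natDegree h
    rw [natDegree_mul hR0 (hQ0 n), natDegree_C_mul hv, natDegree_mul (mul_ne_zero hG hb) ha,
      hd₁, hR] at this
    omega
  have hQA : ∀ n : ℕ, IsCoprime (B - C (n : k) * A) A := by
    intro n
    have := hAB.symm.add_mul_right_left (-C (n : k))
    rwa [neg_mul, ← sub_eq_add_neg] at this
  have hQQ : ∀ n < p, ∀ m < p, n ≠ m → IsCoprime (B - C (n : k) * A) (B - C (m : k) * A) := by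
    intro n hn m hm hnm
    have hne : (n : k) - m ≠ 0 := by
      refine sub_ne_zero.2 fun h => hnm ?_
      exact CharP.natCast_injOn_Iio k p hn hm h
    have h1 : IsCoprime (B - C (n : k) * A) (C ((n : k) - m) * A) :=
      (isCoprime_mul_unit_left_right (isUnit_C.2 hne.isUnit) _ _).2 (hQA n)
    have h2 := h1.add_mul_left_right 1
    have e : C ((n : k) - m) * A + (B - C (n : k) * A) * 1 = B - C (m : k) * A := by
      rw [C_sub]; ring
    rwa [e] at h2
  set D := ∏ n ∈ Finset.range p, (B - C (n : k) * A) with hD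
  have hD0 : D ≠ 0 := Finset.prod_ne_zero_iff.2 fun n _ => hQ0 n
  have hDdeg : D.natDegree = p * a.natDegree := by
    rw [hD, natDegree_prod _ _ fun n _ => hQ0 n, Finset.sum_congr rfl fun n _ => hQdeg n]
    simp
  have hDeq : D = B ^ p - A ^ (p - 1) * B := prod_sub_natCast_mul A B
  -- the fibres over `1, …, p - 1` lie among the common zeros of the two denominators
  have hDdvd : D ∣ G * b := by
    have hsplit : D = (∏ n ∈ Finset.Ico 1 p, (B - C (n : k) * A)) * B := by
      rw [hD, Finset.range_eq_Ico, Finset.prod_eq_prod_Ico_succ_bot hp0]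
      simp [mul_comm]
    have hdvdG : ∏ n ∈ Finset.Ico 1 p, (B - C (n : k) * A) ∣ G := by
      refine Finset.prod_dvd_of_coprime (fun n hn m hm hnm => ?_) fun n hn => ?_
      · rw [Finset.coe_Ico] at hn hm
        exact hQQ n hn.2 m hm.2 hnm
      · obtain ⟨hn1, hnp⟩ := Finset.mem_Ico.1 hn
        obtain ⟨v, R, hv, -, -, h⟩ := hfib n
        have hdv : B - C (n : k) * A ∣ C v * (G * b * a) := ⟨R, by rw [← h, mul_comm]⟩
        have h1 := ((isUnit_C.2 hv.isUnit).dvd_mul_left).1 hdv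
        have hQa : IsCoprime (B - C (n : k) * A) a :=
          (isCoprime_mul_unit_left_right hC₁ _ _).1 (hQA n)
        have hQb : IsCoprime (B - C (n : k) * A) b := by
          refine (isCoprime_mul_unit_left_right hC₂ _ _).1 ?_
          have := hQQ n hnp 0 hp0 (by omega)
          simpa using this
        exact hQb.dvd_of_dvd_mul_right (hQa.dvd_of_dvd_mul_right h1)
    rw [hsplit, hB, mul_left_comm]
    exact (hC₂.mul_left_dvd).2 (mul_dvd_mul_right hdvdG b)
  -- conversely each pole of the first form lies on the fibre over a ratio of residues
  have hdvdD : G * b ∣ D := by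
    refine dvd_of_simple_roots hP₁ hD0 fun x hx => ?_
    obtain ⟨m₁, hm₁⟩ := hr₁ x hx
    refine ⟨fun h0 => hu₁ (by rw [← hm₁, h0, mul_zero]), ?_⟩
    have hm₁0 : (m₁ : k) ≠ 0 := fun h0 => hu₁ (by rw [← hm₁, h0, zero_mul])
    rw [eval_mul, mul_eq_zero] at hx
    rw [hD, eval_prod, Finset.prod_eq_zero_iff]
    rcases eq_or_ne (b.eval x) 0 with hbx | hbx
    · exact ⟨0, Finset.mem_range.2 hp0, by simp [hB, hbx]⟩
    · have hGx : G.eval x = 0 := hx.resolve_right hbx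
      obtain ⟨m₂, hm₂⟩ := hr₂ x (by rw [eval_mul, hGx, zero_mul])
      have hnat : ∀ n : ℕ, (n : k) ^ p = n := fun n => map_natCast (frobenius k p) n
      obtain ⟨n, hn, hnm⟩ := exists_natCast_of_pow_eq_self (p := p) (y := (m₂ : k) / m₁)
        (by rw [div_pow, hnat, hnat])
      refine ⟨n, Finset.mem_range.2 hn, ?_⟩
      rw [eq_div_iff hm₁0] at hnm
      simp only [derivative_mul, eval_add, eval_mul, hGx, zero_mul, add_zero] at hm₁ hm₂
      simp only [hA, hB, eval_sub, eval_mul, eval_C]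
      rw [← hm₁, ← hm₂, ← hnm]
      ring
  obtain ⟨κ, hκ0, hκ⟩ : ∃ κ : k, κ ≠ 0 ∧ D = C κ * (G * b) := by
    obtain ⟨w, hw⟩ := associated_of_dvd_dvd hdvdD hDdvd
    obtain ⟨κ, hκ, hκw⟩ := isUnit_iff.1 w.isUnit
    exact ⟨κ, hκ.ne_zero, by rw [← hw, ← hκw, mul_comm]⟩
  have hal : a.natDegree = l := by
    rw [hκ, natDegree_C_mul hκ0, hd₁, mul_comm] at hDdeg
    exact (Nat.eq_of_mul_eq_mul_left hp0 hDdeg).symm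
  refine ⟨A, B, κ * u₁, hAB, by rw [hA, natDegree_C_mul hu₁, hal], mul_ne_zero hκ0 hu₁,
    fun n => by rw [hQdeg, hal], fun n x hx => ?_⟩
  have hAx : (B.eval x) = n * A.eval x := by
    simpa [sub_eq_zero] using hx
  have hDx : D.eval x = 0 := by
    have hnat : (n : k) ^ p = n := map_natCast (frobenius k p) n
    rw [hDeq]
    simp only [eval_sub, eval_mul, eval_pow, hAx, mul_pow, hnat]
    conv_lhs => enter [1, 2]; rw [← Nat.sub_add_cancel hp0, pow_succ]
    ring
  have hPx : (G * b).eval x = 0 := by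
    rw [hκ, eval_mul, eval_C] at hDx
    exact (mul_eq_zero.1 hDx).resolve_left hκ0
  obtain ⟨m, hm⟩ := hr₁ x hPx
  refine ⟨m, ?_⟩
  have hder := derivative_pow_sub_pow_mul (p := p) A B
  rw [← hDeq, hκ, derivative_C_mul] at hder
  have h := congrArg (eval x) hder
  rw [eval_mul, eval_C, eval_mul, eval_pow] at h
  rw [← h, ← hm]
  ring

end LogForms

theorem mainTheorem1 (p : ℕ) [Fact p.Prime] (k : Type*) [Field k] [IsAlgClosed k] [CharP k p]
    [Algebra (ZMod p) k] (l : ℕ) (hl : 0 < l) (hp : 3 * l < p) :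
    ¬ ∃ Ω : Submodule (ZMod p) (LogForms.MeroForm k), LogForms.IsSpaceL p (l * p) 2 Ω := by
  open LogForms Polynomial in
  rintro ⟨Ω, hΩ⟩
  have hfin : Module.finrank (ZMod p) Ω = 2 := Module.finrank_eq_of_rank_eq hΩ.rank_eq
  have hspan : ∃ ω₁ ∈ Ω, ∃ ω₂ ∈ Ω, ω₁ ≠ 0 ∧ ω₂ ≠ 0 ∧ ∀ n : ℕ, ω₂ - n • ω₁ ≠ 0 := by
    have : Module.Finite (ZMod p) Ω := Module.finite_of_finrank_pos (by omega)
    let e := Module.finBasisOfFinrankEq (ZMod p) Ω hfin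
    have hli := e.linearIndependent
    refine ⟨e 0, (e 0).2, e 1, (e 1).2, ?_, ?_, fun n hn => ?_⟩
    · simpa using e.ne_zero 0
    · simpa using e.ne_zero 1
    · have h1 : e 1 - (n : ZMod p) • e 0 = 0 := by
        rw [Nat.cast_smul_eq_nsmul]
        exact Subtype.ext hn
      have h2 := congrArg (fun v => e.repr v 1) h1
      simp at h2
  obtain ⟨ω₁, h₁, ω₂, h₂, hne₁, hne₂, hne⟩ := hspan
  obtain ⟨u₁, P₁, hu₁, hP₁, hd₁, hf₁, hr₁⟩ := hΩ.exists_denominator h₁ hne₁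
  obtain ⟨u₂, P₂, hu₂, hP₂, -, hf₂, hr₂⟩ := hΩ.exists_denominator h₂ hne₂
  obtain ⟨A, B, γ, hAB, hA, hγ, hdeg, hres⟩ :=
    pencil_of_residues hu₁ hu₂ hP₁ hP₂ hd₁ hr₁ hr₂ fun n => by
      obtain ⟨v, R, hv, hR0, hRd, hfR, -⟩ :=
        hΩ.exists_denominator (Ω.sub_mem h₂ (Ω.nsmul_mem h₁ n)) (hne n)
      refine ⟨v, R, hv, hR0, hRd, RatFunc.algebraMap_injective k ?_⟩
      rw [coeff_sub_nsmul] at hfR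
      have hn : algebraMap k[X] (RatFunc k) (C (n : k)) = n := by
        rw [map_natCast, map_natCast]
      simp only [map_mul, map_sub, hn, ← hfR, ← hf₁, ← hf₂]
      ring
  exact pencil_residue_false hl hp hAB hA hdeg hγ hres
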